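/- Let $W$ be the Coxeter group of type $\widetilde A_3$, that is, the Coxeter group with generating set $S=\{p,r,s,t\}$ and $m_{pr}=m_{rs}=m_{st}=m_{tp}=3$, $m_{ps}=m_{rt}=2$. Let $\ell$ be the word length on $W$ with respect to $S$. For $g\in W$ let $T(g)=\{u\in S:\ell(gu)<\ell(g)\}$ and let $w(g)$ be the longest element of the (finite) subgroup $\langle T(g)\rangle$. For a word $v\in S^*$ of length $N$ let $v(i)$ denote its prefix of length $i$ if $i<N$, and $v$ itself if $i\ge N$; words are identified with the elements of $W$ that they represent inside $\ell(\cdot)$. The standard language $\mathcal L\subset S^*$ is defined inductively: the only word in $\mathcal L$ representing the identity is the empty word; a word $v$ of length $N$ representing $g\neq 1$ is in $\mathcal L$ if and only if, with $k=\ell(w(g))$, the prefix $v(N-k)$ is in $\mathcal L$ and the remaining subword of length $k$ represents $w(g)$. Theorem. The language $\mathcal L$ does not satisfy part (ii) of the definition of biautomaticity (the fellow traveller property). That is, there is no constant $C>0$ such that for all $u\in S$, all $g,g'\in W$ with $g'=gu$, all $v,v'\in\mathcal L$ representing $g,g'$, and all $i\ge 1$, we have $\ell(v(i)^{-1}v'(i))\le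 C$. Moreover, the words drift apart linearly: for every $m\in\mathbb N$ there are $g\in W$ and $u\in S$ such that for all $v,v'\in\mathcal L$ representing $g,gu$, of lengths $N,N'$, and every even $n$ with $0\le n\le m$, we have $3n\le N$, $3n\le N'$ and $\ell\bigl(v(N-3n)^{-1}v'(N'-3n)\bigr)\ge n$. -/

import Mathlib

namespace CoxeterSystem

variable {B : Type*} {M : CoxeterMatrix B} {W : Type*} [Group W]

/-- `T(g)`: the set of (indices of) simple reflections `s` with `ℓ(gs) < ℓ(g)`. -/
def rightDescentSet (cs : CoxeterSystem M W) (g : W) : Set B :=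
  {i | cs.IsRightDescent g i}

/-- The subgroup `⟨T⟩` of `W` generated by a set `T` of simple reflections. -/
def standardParabolic (cs : CoxeterSystem M W) (T : Set B) : Subgroup W :=
  Subgroup.closure (cs.simple '' T)

/-- `w` is the longest element of the subgroup `⟨T(g)⟩`, that is, `w = w(g)`.
(In a Coxeter group with finitely many generators, `⟨T(g)⟩` is always finite and its element of
maximal length exists and is unique.) -/
def IsLongestDescentElement (cs : CoxeterSystem M W) (g w : W) : Prop :=
  w ∈ cs.standardParabolic (cs.rightDescentSet g) ∧
    ∀ u ∈ cs.standardParabolic (cs.rightDescentSet g), cs.length u ≤ cs.length w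

/-- Membership in the standard language. The only standard word representing the identity is the
empty word. A word `v` representing `g ≠ 1` is standard iff `v = u x`, where `x` has length
`ℓ(w(g))` and represents `w(g)`, and the remaining prefix `u` is standard. -/
inductive IsStandardWord (cs : CoxeterSystem M W) : List B → Prop
  | nil : IsStandardWord cs []
  | append (u x : List B)
      (ne_one : cs.wordProd (u ++ x) ≠ 1)
      (longest : cs.IsLongestDescentElement (cs.wordProd (u ++ x)) (cs.wordProd x))
      (length_eq : x.length = cs.length (cs.wordProd x))
      (prefix_mem : IsStandardWord cs u) : IsStandardWord cs (u ++ x)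

/-- The standard language of a Coxeter system. -/
def standardLanguage (cs : CoxeterSystem M W) : Language B :=
  {v | cs.IsStandardWord v}

/-- Part (ii) of the definition of biautomaticity for the language `L`: there is a constant
`C > 0` such that any words `v`, `v'` in `L` representing elements `g` and `g' = gs`, with `s` a
generator, satisfy `ℓ(v(i)⁻¹ v'(i)) ≤ C` for all `i ≥ 1`. Here `v(i)` is the prefix of `v` of
length `i`, and `v` itself if `i` is at least the length of `v`. -/
def FellowTravellerProperty (cs : CoxeterSystem M W) (L : Language B) : Prop :=
  ∃ C : ℝ, 0 < C ∧
    ∀ (s : B) (g g' : W), g' = g * cs.simple s →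
      ∀ v ∈ L, ∀ v' ∈ L, cs.wordProd v = g → cs.wordProd v' = g' →
        ∀ i : ℕ, 1 ≤ i →
          (cs.length ((cs.wordProd (v.take i))⁻¹ * cs.wordProd (v'.take i)) : ℝ) ≤ C

end CoxeterSystem

/-- The Coxeter matrix of the Euclidean Coxeter group `Ã₃`: the generators `p, r, s, t` are
`0, 1, 2, 3`, with `m_{pr} = m_{rs} = m_{st} = m_{tp} = 3` and `m_{ps} = m_{rt} = 2`. -/
def coxeterMatrixAffineA3 : CoxeterMatrix (Fin 4) where
  M := !![1, 3, 2, 3;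
          3, 1, 3, 2;
          2, 3, 1, 3;
          3, 2, 3, 1]
  isSymm := by
    ext i j
    fin_cases i <;> fin_cases j <;> rfl
  diagonal := by
    intro i
    fin_cases i <;> rfl
  off_diagonal := by
    intro i j h
    fin_cases i <;> fin_cases j <;> simp_all

/-! `W` acts on `ℤ` by affine permutations, and `i` is a right descent of `w` exactly when `w(i+1) <
w(i)`. Descent sets can therefore be read off from values, and since a generator moves each integer
by at most one, displacement bounds length from below. Faithfulness of the action is never needed.

Take `g` to be the translation by `(3k, -k, -3k, k)`. Its values decrease along positions 1, 2, 3,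
so its last block is the longest element of an `A₂`, of length 3; removing it reverses those three
values and makes positions 3, 4, 5 decreasing. Thus standard words for `g` end in a long run of
alternating `A₂` blocks, which move only odd positions. Multiplying `g` by `s₁` puts the two large
values at even positions and the two small ones at odd positions. Now the descents are `{0, 2}`,
then `{1, 3}`, and so on, and the blocks are of type `A₁ × A₁`, of length 2, moving every position.

Deleting `6r` letters removes `2r` blocks from one word and `3r` from the other. The first product
fixes even integers and the second moves each integer by `3r`, so the prefixes are at distance at
least `3r`. Both runs persist as long as the gaps between values, proportional to `k`, exceed the
drift of the positions. -/

namespace AffineA3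

open CoxeterSystem

/-! ### The action of `Ã₃` on `ℤ` by affine permutations -/

/-- The affine adjacent transposition exchanging `x` and `x + 1` whenever `x ≡ i (mod 4)`. -/
def adjacentSwap (i : Fin 4) : Equiv.Perm ℤ where
  toFun x := if x % 4 = (i : ℕ) then x + 1 else if (x - 1) % 4 = (i : ℕ) then x - 1 else x
  invFun x := if x % 4 = (i : ℕ) then x + 1 else if (x - 1) % 4 = (i : ℕ) then x - 1 else x
  left_inv x := by dsimp only; split_ifs <;> omega
  right_inv x := by dsimp only; split_ifs <;> omega

theorem adjacentSwap_apply (i : Fin 4) (x : ℤ) :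
    adjacentSwap i x =
      if x % 4 = (i : ℕ) then x + 1 else if (x - 1) % 4 = (i : ℕ) then x - 1 else x := rfl

theorem coxeterMatrix_cases (i j : Fin 4) (h : i ≠ j) :
    (coxeterMatrixAffineA3.M i j = 2 ∧ (j : ℕ) = (i + 2) % 4) ∨
    (coxeterMatrixAffineA3.M i j = 3 ∧ ((j : ℕ) = (i + 1) % 4 ∨ (j : ℕ) = (i + 3) % 4)) := by
  revert h
  fin_cases i <;> fin_cases j <;> simp [coxeterMatrixAffineA3]

theorem adjacentSwap_of_mod {i : Fin 4} {x : ℤ} (h : x % 4 = (i : ℕ)) :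
    adjacentSwap i x = x + 1 := if_pos h

theorem adjacentSwap_of_sub_one_mod {i : Fin 4} {x : ℤ} (h : (x - 1) % 4 = (i : ℕ)) :
    adjacentSwap i x = x - 1 := by
  rw [adjacentSwap_apply, if_neg (by omega), if_pos h]

theorem adjacentSwap_of_ne {i : Fin 4} {x : ℤ} (h : x % 4 ≠ (i : ℕ))
    (h' : (x - 1) % 4 ≠ (i : ℕ)) : adjacentSwap i x = x := by
  rw [adjacentSwap_apply, if_neg h, if_neg h']

theorem adjacentSwap_mul_self (i : Fin 4) : adjacentSwap i * adjacentSwap i = 1 :=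
  Equiv.ext (adjacentSwap i).left_inv

theorem isLiftable_adjacentSwap : coxeterMatrixAffineA3.IsLiftable adjacentSwap := by
  intro i j
  have hi := adjacentSwap_mul_self i
  have hj := adjacentSwap_mul_self j
  by_cases h : i = j
  · subst h
    rw [hi, one_pow]
  have hlt := i.isLt
  rcases coxeterMatrix_cases i j h with ⟨hm, hij⟩ | ⟨hm, hij⟩
  · have hc : adjacentSwap i * adjacentSwap j = adjacentSwap j * adjacentSwap i := by
      ext x
      simp only [Equiv.Perm.mul_apply]
      have hx : x % 4 = (i : ℕ) ∨ (x - 1) % 4 = (i : ℕ) ∨ (x - 2) % 4 = (i : ℕ) ∨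
        (x - 3) % 4 = (i : ℕ) := by omega
      rcases hx with hx | hx | hx | hx <;>
      simp (disch := omega) only [adjacentSwap_of_mod, adjacentSwap_of_sub_one_mod,
        adjacentSwap_of_ne]
    rw [hm, pow_two]
    nth_rewrite 1 [hc]
    rw [mul_assoc, ← mul_assoc (adjacentSwap i), hi, one_mul, hj]
  · have hr : adjacentSwap i * adjacentSwap j * adjacentSwap i =
        adjacentSwap j * adjacentSwap i * adjacentSwap j := by
      ext x
      simp only [Equiv.Perm.mul_apply]
      have hx : x % 4 = (i : ℕ) ∨ (x - 1) % 4 = (i : ℕ) ∨ (x - 2) % 4 = (i : ℕ) ∨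
        (x - 3) % 4 = (i : ℕ) := by omega
      rcases hij with hij | hij <;> rcases hx with hx | hx | hx | hx <;>
      simp (disch := omega) only [adjacentSwap_of_mod, adjacentSwap_of_sub_one_mod,
        adjacentSwap_of_ne] <;> omega
    calc (adjacentSwap i * adjacentSwap j) ^ (coxeterMatrixAffineA3.M i j)
        = (adjacentSwap i * adjacentSwap j * adjacentSwap i) *
          (adjacentSwap j * adjacentSwap i * adjacentSwap j) := by
          rw [hm]
          simp only [pow_succ, pow_zero, one_mul, mul_assoc]
      _ = (adjacentSwap j * (adjacentSwap i * (adjacentSwap j * adjacentSwap j)) *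
            adjacentSwap i) * adjacentSwap j := by
          rw [hr]
          simp only [mul_assoc]
      _ = 1 := by rw [hj, mul_one, mul_assoc (adjacentSwap j), hi, mul_one, hj]

variable {W : Type*} [Group W] (cs : CoxeterSystem coxeterMatrixAffineA3 W)

/-- The action of a Coxeter group of type `Ã₃` on `ℤ` by affine permutations. -/
def toPerm : W →* Equiv.Perm ℤ :=
  cs.lift ⟨adjacentSwap, isLiftable_adjacentSwap⟩

@[simp]
theorem toPerm_simple (i : Fin 4) : toPerm cs (cs.simple i) = adjacentSwap i :=
  cs.lift_apply_simple isLiftable_adjacentSwap i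

theorem toPerm_simple_apply (i : Fin 4) (x : ℤ) : toPerm cs (cs.simple i) x =
    if x % 4 = (i : ℕ) then x + 1 else if (x - 1) % 4 = (i : ℕ) then x - 1 else x := by
  rw [toPerm_simple, adjacentSwap_apply]

theorem abs_toPerm_sub_le_length (w : W) (x : ℤ) : |toPerm cs w x - x| ≤ cs.length w := by
  obtain ⟨l, hl, rfl⟩ := cs.exists_isReduced w
  rw [hl.eq]
  clear hl
  induction l with
  | nil => simp
  | cons i l ih =>
    rw [cs.wordProd_cons, map_mul, Equiv.Perm.mul_apply, toPerm_simple_apply, List.length_cons]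
    rw [abs_le] at ih ⊢
    push_cast
    split_ifs <;> constructor <;> linarith [ih.1, ih.2]

/-! ### Descents -/

theorem simple_mul_simple_comm {i j : Fin 4} (h : coxeterMatrixAffineA3.M i j = 2) :
    cs.simple i * cs.simple j = cs.simple j * cs.simple i := by
  have h1 := cs.simple_mul_simple_pow i j
  change _ ^ (coxeterMatrixAffineA3.M i j) = 1 at h1
  rw [h, pow_two] at h1
  rw [eq_inv_of_mul_eq_one_left h1]
  simp

theorem simple_braid {i j : Fin 4} (h : coxeterMatrixAffineA3.M i j = 3) :
    cs.simple i * cs.simple j * cs.simple i = cs.simple j * cs.simple i * cs.simple j := by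
  have h1 := cs.simple_mul_simple_pow i j
  change _ ^ (coxeterMatrixAffineA3.M i j) = 1 at h1
  rw [h, pow_succ, pow_two] at h1
  have h2 : (cs.simple i * cs.simple j * cs.simple i) *
      (cs.simple j * cs.simple i * cs.simple j) = 1 := by
    rw [← h1]; simp only [mul_assoc]
  rw [eq_inv_of_mul_eq_one_left h2]
  simp [mul_assoc]

/-- Induction on length: strip a right descent `j` of `w`, and then also `i` if it becomes a
descent. The remaining factor is increasing across the needed edges, and the stripped dihedral part
acts explicitly on `x` and `x + 1`. -/
theorem toPerm_lt_of_not_isRightDescent (w : W) (i : Fin 4) (hw : ¬ cs.IsRightDescent w i)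
    (x : ℤ) (hx : x % 4 = (i : ℕ)) : toPerm cs w x < toPerm cs w (x + 1) := by
  induction hn : cs.length w using Nat.strong_induction_on generalizing w i x with
  | _ n ih =>
  by_cases h1 : w = 1
  · subst h1; simp
  obtain ⟨j, hj⟩ := cs.exists_rightDescent_of_ne_one h1
  have hij : i ≠ j := by rintro rfl; exact hw hj
  have hi := i.isLt
  have hjl := j.isLt
  rw [cs.isRightDescent_iff] at hj
  rw [cs.not_isRightDescent_iff] at hw
  have hwv : w = w * cs.simple j * cs.simple j := by simp
  have hjx (y : ℤ) := toPerm_simple_apply cs j y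
  have key (y : ℤ) : toPerm cs w y = toPerm cs (w * cs.simple j) (toPerm cs (cs.simple j) y) := by
    rw [← Equiv.Perm.mul_apply, ← map_mul, ← hwv]
  have hvj : ¬ cs.IsRightDescent (w * cs.simple j) j := by
    rw [cs.not_isRightDescent_iff, ← hwv]; omega
  have ihj (y : ℤ) (hy : y % 4 = (j : ℕ)) :=
    ih _ (by omega) (w * cs.simple j) j hvj y hy rfl
  rcases coxeterMatrix_cases i j hij with ⟨hm, hmod⟩ | ⟨hm, hmod⟩
  · have hvi : ¬ cs.IsRightDescent (w * cs.simple j) i := by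
      intro hd
      rw [cs.isRightDescent_iff, mul_assoc, ← simple_mul_simple_comm cs hm, ← mul_assoc] at hd
      rcases cs.length_mul_simple (w * cs.simple i) j with h | h <;> omega
    have := ih _ (by omega) _ i hvi x hx rfl
    rw [key, key, hjx, hjx]
    rwa [if_neg (by omega), if_neg (by omega), if_neg (by omega), if_neg (by omega)]
  · by_cases hvi : cs.IsRightDescent (w * cs.simple j) i
    -- Otherwise `w s_j s_i s_j` would have length `ℓ(w) - 3`. By the braid relation `w s_i` is that
    -- element times `s_i s_j`, so it would be shorter than `w`.
    · have hvij : ¬ cs.IsRightDescent (w * cs.simple j * cs.simple i) j := by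
        intro hd
        rw [cs.isRightDescent_iff] at hd hvi
        have e : w * cs.simple i = w * cs.simple j * cs.simple i * cs.simple j *
            cs.simple i * cs.simple j := by
          have hb := simple_braid cs hm
          calc w * cs.simple i = w * (cs.simple i * cs.simple j * cs.simple i) *
                cs.simple i * cs.simple j := by simp [mul_assoc]
            _ = _ := by rw [hb]; simp only [mul_assoc]
        have l1 := cs.length_mul_simple
          (w * cs.simple j * cs.simple i * cs.simple j * cs.simple i) j
        have l2 := cs.length_mul_simple (w * cs.simple j * cs.simple i * cs.simple j) i
        rw [← e] at l1
        omega
      rw [cs.isRightDescent_iff] at hvi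
      have key2 (y : ℤ) : toPerm cs w y = toPerm cs (w * cs.simple j * cs.simple i)
          (toPerm cs (cs.simple i) (toPerm cs (cs.simple j) y)) := by
        rw [← Equiv.Perm.mul_apply, ← Equiv.Perm.mul_apply, ← map_mul, ← map_mul]
        simp [mul_assoc]
      have ihv (y : ℤ) (hy : y % 4 = (j : ℕ)) := ih _ (by omega) _ j hvij y hy rfl
      have hix (y : ℤ) := toPerm_simple_apply cs i y
      rw [key2, key2]
      rcases hmod with hmod | hmod
      · have e1 : toPerm cs (cs.simple i) (toPerm cs (cs.simple j) x) = x + 1 := by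
          rw [hjx, if_neg (by omega), if_neg (by omega), hix, if_pos hx]
        have e2 : toPerm cs (cs.simple i) (toPerm cs (cs.simple j) (x + 1)) = x + 1 + 1 := by
          rw [hjx, if_pos (by omega), hix, if_neg (by omega), if_neg (by omega)]
        rw [e1, e2]
        exact ihv (x + 1) (by omega)
      · have e1 : toPerm cs (cs.simple i) (toPerm cs (cs.simple j) x) = x - 1 := by
          rw [hjx, if_neg (by omega), if_pos (by omega), hix, if_neg (by omega), if_neg (by omega)]
        have e2 : toPerm cs (cs.simple i) (toPerm cs (cs.simple j) (x + 1)) = x - 1 + 1 := by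
          rw [hjx, if_neg (by omega), if_neg (by omega), hix, if_neg (by omega), if_pos (by omega)]
          ring
        rw [e1, e2]
        exact ihv (x - 1) (by omega)
    · have ihi (y : ℤ) (hy : y % 4 = (i : ℕ)) := ih _ (by omega) _ i hvi y hy rfl
      rw [key, key]
      rcases hmod with hmod | hmod
      · have e1 : toPerm cs (cs.simple j) x = x := by
          rw [hjx, if_neg (by omega), if_neg (by omega)]
        have e2 : toPerm cs (cs.simple j) (x + 1) = x + 1 + 1 := by
          rw [hjx, if_pos (by omega)]
        rw [e1, e2]
        exact (ihi x hx).trans (ihj (x + 1) (by omega))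
      · have e1 : toPerm cs (cs.simple j) x = x - 1 := by
          rw [hjx, if_neg (by omega), if_pos (by omega)]
        have e2 : toPerm cs (cs.simple j) (x + 1) = x + 1 := by
          rw [hjx, if_neg (by omega), if_neg (by omega)]
        rw [e1, e2]
        have := ihj (x - 1) (by omega)
        rw [sub_add_cancel] at this
        exact this.trans (ihi x hx)

/-- Right descents of an element of `Ã₃` are the descents of the associated affine permutation. -/
theorem isRightDescent_iff_toPerm_lt (w : W) (i : Fin 4) (x : ℤ) (hx : x % 4 = (i : ℕ)) :
    cs.IsRightDescent w i ↔ toPerm cs w (x + 1) < toPerm cs w x := by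
  constructor
  · intro h
    rw [cs.isRightDescent_iff_not_isRightDescent_mul] at h
    have := toPerm_lt_of_not_isRightDescent cs _ i h x hx
    rw [map_mul, Equiv.Perm.mul_apply, Equiv.Perm.mul_apply, toPerm_simple_apply,
      toPerm_simple_apply, if_pos hx, if_neg (by omega), if_pos (by omega)] at this
    simpa using this
  · intro h
    by_contra hd
    exact lt_asymm h (toPerm_lt_of_not_isRightDescent cs w i hd x hx)

theorem isRightDescent_iff (w : W) (i : Fin 4) :
    cs.IsRightDescent w i ↔ toPerm cs w ((i : ℕ) + 1) < toPerm cs w (i : ℕ) :=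
  isRightDescent_iff_toPerm_lt cs w i _ (by have := i.isLt; omega)

/-! ### Parabolic subgroups and longest elements -/

/-- Every integer `z` with `z` and `z + 1` both between `a` and `b` is congruent to an index in
`T`. -/
def SameBlock (T : Set (Fin 4)) (a b : ℤ) : Prop :=
  ∀ z : ℤ, (a ≤ z ∧ z < b ∨ b ≤ z ∧ z < a) → ∃ i ∈ T, z % 4 = (i : ℕ)

theorem SameBlock.symm {T : Set (Fin 4)} {a b : ℤ} (h : SameBlock T a b) : SameBlock T b a :=
  fun z hz ↦ h z hz.symm

theorem SameBlock.trans {T : Set (Fin 4)} {a b c : ℤ} (h : SameBlock T a b)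
    (h' : SameBlock T b c) : SameBlock T a c := by
  intro z hz
  by_cases hb : a ≤ z ∧ z < b ∨ b ≤ z ∧ z < a
  · exact h z hb
  · exact h' z (by omega)

theorem sameBlock_toPerm {T : Set (Fin 4)} {u : W} (hu : u ∈ cs.standardParabolic T) (x : ℤ) :
    SameBlock T x (toPerm cs u x) := by
  induction hu using Subgroup.closure_induction generalizing x with
  | mem u hu =>
    obtain ⟨i, hi, rfl⟩ := hu
    intro z hz
    rw [toPerm_simple_apply] at hz
    refine ⟨i, hi, ?_⟩
    split_ifs at hz
    · rwa [show z = x by omega]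
    · rwa [show z = x - 1 by omega]
    · omega
  | one => intro z hz; simp at hz; omega
  | mul u v _ _ hu hv =>
    rw [map_mul, Equiv.Perm.mul_apply]
    exact (hv x).trans (hu _)
  | inv u _ hu =>
    have := hu ((toPerm cs u)⁻¹ x)
    rw [← Equiv.Perm.mul_apply, mul_inv_cancel, Equiv.Perm.one_apply] at this
    rw [map_inv]
    exact this.symm

theorem toPerm_lt_of_sameBlock {T : Set (Fin 4)} {g : W} (hT : T ⊆ cs.rightDescentSet g)
    {a b : ℤ} (hab : a < b) (h : SameBlock T a b) : toPerm cs g b < toPerm cs g a := by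
  induction b, hab using Int.leInduction with
  | base =>
    obtain ⟨i, hi, hz⟩ := h a (by omega)
    exact (isRightDescent_iff_toPerm_lt cs g i a hz).1 (hT hi)
  | succ b hb ih =>
    obtain ⟨i, hi, hz⟩ := h b (by omega)
    exact ((isRightDescent_iff_toPerm_lt cs g i b hz).1 (hT hi)).trans
      (ih fun z hz ↦ h z (by omega))

/-- On each block of positions joined by `T`, `g` is strictly decreasing, while `u` preserves
blocks. Hence for `i ∈ T` exactly one of `u` and `g * u` has the right descent `i`, and the two
lengths change oppositely when `u` is multiplied by `s_i`. -/
theorem length_mul_add_length {T : Set (Fin 4)} {g u : W} (hT : T ⊆ cs.rightDescentSet g)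
    (hu : u ∈ cs.standardParabolic T) :
    cs.length (g * u) + cs.length u = cs.length g := by
  have step : ∀ u ∈ cs.standardParabolic T, ∀ i ∈ T,
      cs.length (g * u) + cs.length u = cs.length g →
      cs.length (g * (u * cs.simple i)) + cs.length (u * cs.simple i) = cs.length g := by
    intro u hu i hi h
    set a : ℤ := ((i : ℕ) : ℤ) with ha
    have hblock : SameBlock T (toPerm cs u a) (toPerm cs u (a + 1)) := by
      refine ((sameBlock_toPerm cs hu a).symm.trans ?_).trans (sameBlock_toPerm cs hu (a + 1))
      intro z hz
      exact ⟨i, hi, by have := i.isLt; omega⟩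
    have hmod : a % 4 = (i : ℕ) := by have := i.isLt; omega
    have key := isRightDescent_iff_toPerm_lt cs (g * u) i a hmod
    have key' := isRightDescent_iff_toPerm_lt cs u i a hmod
    rw [map_mul, Equiv.Perm.mul_apply, Equiv.Perm.mul_apply] at key
    rw [← mul_assoc]
    by_cases hd : cs.IsRightDescent u i
    · have hlt := toPerm_lt_of_sameBlock cs hT (key'.1 hd) hblock.symm
      have hn : ¬ cs.IsRightDescent (g * u) i := fun h' ↦ lt_asymm hlt (key.1 h')
      rw [cs.not_isRightDescent_iff] at hn
      rw [cs.isRightDescent_iff] at hd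
      omega
    · have hne : toPerm cs u a ≠ toPerm cs u (a + 1) := by
        intro h; have := (toPerm cs u).injective h; omega
      have hlt := toPerm_lt_of_sameBlock cs hT
        (lt_of_le_of_ne (not_lt.1 fun h' ↦ hd (key'.2 h')) hne) hblock
      have hn := key.2 hlt
      rw [cs.isRightDescent_iff] at hn
      rw [cs.not_isRightDescent_iff] at hd
      omega
  unfold standardParabolic at *
  induction hu using Subgroup.closure_induction_right with
  | one => simp
  | mul_right u hu y hy ih =>
    obtain ⟨i, hi, rfl⟩ := hy
    exact step u hu i hi ih
  | mul_inv_cancel u hu y hy ih =>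
    obtain ⟨i, hi, rfl⟩ := hy
    rw [cs.inv_simple]
    exact step u hu i hi ih

theorem simple_mem_standardParabolic {T : Set (Fin 4)} {i : Fin 4} (hi : i ∈ T) :
    cs.simple i ∈ cs.standardParabolic T :=
  Subgroup.subset_closure ⟨i, hi, rfl⟩

/-- If `w` has all the required descents, `length_mul_add_length` with `w` in place of `g` bounds
the length of every element of the parabolic subgroup by `ℓ(w)`. -/
theorem isLongestDescentElement_iff {g w : W} : cs.IsLongestDescentElement g w ↔
    w ∈ cs.standardParabolic (cs.rightDescentSet g) ∧
      cs.rightDescentSet g ⊆ cs.rightDescentSet w := by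
  refine and_congr_right fun hw ↦ ⟨fun h i hi ↦ ?_, fun h u hu ↦ ?_⟩
  · change cs.IsRightDescent w i
    by_contra hd
    rw [cs.not_isRightDescent_iff] at hd
    have := h _ (mul_mem hw (simple_mem_standardParabolic cs hi))
    omega
  · have := length_mul_add_length cs h (mul_mem (inv_mem hw) hu)
    rw [mul_inv_cancel_left] at this
    omega

theorem IsLongestDescentElement.unique {g w w' : W} (h : cs.IsLongestDescentElement g w)
    (h' : cs.IsLongestDescentElement g w') : w = w' := by
  have h1 := length_mul_add_length cs ((isLongestDescentElement_iff cs).1 h).2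
    (mul_mem (inv_mem h.1) h'.1)
  rw [mul_inv_cancel_left, le_antisymm (h'.2 w h.1) (h.2 w' h'.1)] at h1
  have h2 : w⁻¹ * w' = 1 := cs.length_eq_zero_iff.1 (by
    have := h.2 w' h'.1
    have := h'.2 w h.1
    omega)
  exact inv_mul_eq_one.1 h2

/-- Since `ℓ(g * u) + ℓ(u)` is constant on the parabolic subgroup, minimising the first term
maximises the second. Finiteness of the subgroup is not needed. -/
theorem exists_isLongestDescentElement (g : W) : ∃ w, cs.IsLongestDescentElement g w := by
  obtain ⟨w, hw, hmin⟩ := exists_minimalFor_of_wellFoundedLT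
    (· ∈ cs.standardParabolic (cs.rightDescentSet g)) (fun u ↦ cs.length (g * u)) ⟨1, one_mem _⟩
  refine ⟨w, hw, fun u hu ↦ ?_⟩
  have h1 := length_mul_add_length cs subset_rfl hw
  have h2 := length_mul_add_length cs subset_rfl hu
  have h3 := hmin hu
  simp only at h3
  by_cases h : cs.length (g * u) ≤ cs.length (g * w)
  · have := h3 h
    omega
  · omega

/-! ### Standard words -/

theorem length_mul_inv_add_length {g w : W} (h : cs.IsLongestDescentElement g w) :
    cs.length (g * w⁻¹) + cs.length w = cs.length g := by
  rw [← cs.length_inv w]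
  exact length_mul_add_length cs subset_rfl (inv_mem h.1)

theorem length_longestDescentElement_pos {g w : W} (hg : g ≠ 1)
    (h : cs.IsLongestDescentElement g w) : 0 < cs.length w := by
  obtain ⟨i, hi⟩ := cs.exists_rightDescent_of_ne_one hg
  have := h.2 _ (simple_mem_standardParabolic cs (T := cs.rightDescentSet g) hi)
  rw [cs.length_simple] at this
  omega

theorem exists_isStandardWord (g : W) : ∃ v, cs.IsStandardWord v ∧ cs.wordProd v = g := by
  induction hn : cs.length g using Nat.strong_induction_on generalizing g with
  | _ n ih =>
  by_cases hg : g = 1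
  · exact ⟨[], .nil, by simp [hg]⟩
  obtain ⟨w, hw⟩ := exists_isLongestDescentElement cs g
  have h1 := length_mul_inv_add_length cs hw
  have h2 := length_longestDescentElement_pos cs hg hw
  obtain ⟨u, hu, hug⟩ := ih _ (by omega) (g * w⁻¹) rfl
  obtain ⟨x, hx, rfl⟩ := cs.exists_isReduced w
  have hux : cs.wordProd (u ++ x) = g := by
    rw [cs.wordProd_append, hug, inv_mul_cancel_right]
  exact ⟨u ++ x, .append u x (hux ▸ hg) (hux ▸ hw) hx.eq.symm hu, hux⟩

theorem IsStandardWord.length_eq {v : List (Fin 4)} (hv : cs.IsStandardWord v) :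
    v.length = cs.length (cs.wordProd v) := by
  induction hv with
  | nil => simp
  | append u x hne hlong hlen _ ih =>
    have h := length_mul_inv_add_length cs hlong
    rw [cs.wordProd_append u x, mul_inv_cancel_right] at h
    rw [List.length_append, ih, hlen, cs.wordProd_append, h]

/-- Uniqueness of the longest element forces the last block of any standard word, so statements
about all standard words reduce to a chain of group elements. -/
theorem IsStandardWord.take_of_isLongestDescentElement {v : List (Fin 4)}
    (hv : cs.IsStandardWord v) {w : W} (hw : cs.IsLongestDescentElement (cs.wordProd v) w) :
    cs.length w ≤ v.length ∧ cs.IsStandardWord (v.take (v.length - cs.length w)) ∧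
      cs.wordProd (v.take (v.length - cs.length w)) = cs.wordProd v * w⁻¹ := by
  have hlen := length_mul_inv_add_length cs hw
  cases hv with
  | nil =>
    rw [cs.wordProd_nil, cs.length_one] at hlen
    have : cs.length w = 0 := by omega
    refine ⟨by omega, by simpa using IsStandardWord.nil, ?_⟩
    rw [cs.length_eq_zero_iff.1 this]
    simp
  | append u x hne hlong hx hu =>
    obtain rfl := IsLongestDescentElement.unique cs hw hlong
    have h : (u ++ x).take ((u ++ x).length - cs.length (cs.wordProd x)) = u := by
      simp [← hx]
    rw [h]
    exact ⟨by simp [hx], hu, by simp [cs.wordProd_append]⟩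

theorem isStandardWord_take_of_chain (G : ℕ → W) (q J : ℕ)
    (hG : ∀ j < J, ∃ w, cs.IsLongestDescentElement (G j) w ∧ cs.length w = q ∧
      G (j + 1) = G j * w⁻¹)
    {v : List (Fin 4)} (hv : cs.IsStandardWord v) (hv0 : cs.wordProd v = G 0) (j : ℕ)
    (hj : j ≤ J) :
    q * j ≤ v.length ∧ cs.IsStandardWord (v.take (v.length - q * j)) ∧
      cs.wordProd (v.take (v.length - q * j)) = G j := by
  induction j with
  | zero => simpa using ⟨hv, hv0⟩
  | succ j ih =>
    obtain ⟨h1, h2, h3⟩ := ih (by omega)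
    obtain ⟨w, hw, hq, hGj⟩ := hG j (by omega)
    obtain ⟨h4, h5, h6⟩ :=
      IsStandardWord.take_of_isLongestDescentElement cs h2 (h3.symm ▸ hw)
    have hl : (v.take (v.length - q * j)).length = v.length - q * j := by simp
    have e : q * (j + 1) = q * j + q := by ring
    rw [hl, hq] at h4
    rw [hl, hq, List.take_take, min_eq_left (by omega)] at h5 h6
    rw [e, ← Nat.sub_sub]
    exact ⟨by omega, h5, by rw [h6, h3, hGj]⟩

/-! ### Longest elements of the parabolic subgroups of types `A₁ × A₁` and `A₂` -/

theorem toPerm_braid_apply {i j : Fin 4} (hij : (j : ℕ) = (i + 1) % 4) (x : ℤ) :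
    toPerm cs (cs.simple i * cs.simple j * cs.simple i) x =
      if x % 4 = (i : ℕ) then x + 2 else if (x - 2) % 4 = (i : ℕ) then x - 2 else x := by
  have hi := i.isLt
  simp only [map_mul, Equiv.Perm.mul_apply, toPerm_simple]
  have hx : x % 4 = (i : ℕ) ∨ (x - 1) % 4 = (i : ℕ) ∨ (x - 2) % 4 = (i : ℕ) ∨
    (x - 3) % 4 = (i : ℕ) := by omega
  rcases hx with hx | hx | hx | hx <;>
  simp (disch := omega) only [adjacentSwap_of_mod, adjacentSwap_of_sub_one_mod,
    adjacentSwap_of_ne, if_pos, if_neg] <;> omega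

theorem toPerm_commuting_apply {i j : Fin 4} (hij : (j : ℕ) = (i + 2) % 4) (x : ℤ) :
    toPerm cs (cs.simple i * cs.simple j) x =
      if x % 2 = (i : ℕ) % 2 then x + 1 else x - 1 := by
  have hi := i.isLt
  simp only [map_mul, Equiv.Perm.mul_apply, toPerm_simple]
  have hx : x % 4 = (i : ℕ) ∨ (x - 1) % 4 = (i : ℕ) ∨ (x - 2) % 4 = (i : ℕ) ∨
    (x - 3) % 4 = (i : ℕ) := by omega
  rcases hx with hx | hx | hx | hx <;>
  simp (disch := omega) only [adjacentSwap_of_mod, adjacentSwap_of_sub_one_mod,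
    adjacentSwap_of_ne, if_pos, if_neg]

theorem isLongestDescentElement_braid {g : W} {i j : Fin 4} (hij : (j : ℕ) = (i + 1) % 4)
    (hg : cs.rightDescentSet g = {i, j}) :
    cs.IsLongestDescentElement g (cs.simple i * cs.simple j * cs.simple i) ∧
      cs.length (cs.simple i * cs.simple j * cs.simple i) = 3 := by
  have hi := i.isLt
  have hdi : cs.IsRightDescent (cs.simple i * cs.simple j * cs.simple i) i := by
    rw [isRightDescent_iff, toPerm_braid_apply cs hij, toPerm_braid_apply cs hij,
      if_neg (by omega), if_neg (by omega), if_pos (by omega)]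
    omega
  have hdj : cs.IsRightDescent (cs.simple i * cs.simple j * cs.simple i) j := by
    rw [isRightDescent_iff, toPerm_braid_apply cs hij, toPerm_braid_apply cs hij,
      if_neg (by omega), if_pos (by omega), if_neg (by omega), if_neg (by omega)]
    omega
  constructor
  · rw [isLongestDescentElement_iff, hg]
    refine ⟨mul_mem (mul_mem ?_ ?_) ?_, ?_⟩
    · exact simple_mem_standardParabolic cs (by simp)
    · exact simple_mem_standardParabolic cs (by simp)
    · exact simple_mem_standardParabolic cs (by simp)
    · rintro k (rfl | rfl)
      exacts [hdi, hdj]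
  · rw [cs.isRightDescent_iff, cs.simple_mul_simple_cancel_right] at hdi
    -- The product `s_i s_j` moves `i + 2` to `i`, so its length is 2; the descent at `i` adds the
    -- third letter.
    have h1 := abs_toPerm_sub_le_length cs (cs.simple i * cs.simple j) ((i : ℕ) + 2)
    have e : adjacentSwap j ((i : ℕ) + 2) = (i : ℕ) + 1 := by
      rw [adjacentSwap_of_sub_one_mod (by omega)]
      ring
    rw [map_mul, Equiv.Perm.mul_apply, toPerm_simple, toPerm_simple, e,
      adjacentSwap_of_sub_one_mod (by omega), abs_le] at h1
    have h2 := cs.length_mul_le (cs.simple i) (cs.simple j)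
    rw [cs.length_simple, cs.length_simple] at h2
    omega

theorem isLongestDescentElement_commuting {g : W} {i j : Fin 4} (hij : (j : ℕ) = (i + 2) % 4)
    (hg : cs.rightDescentSet g = {i, j}) :
    cs.IsLongestDescentElement g (cs.simple i * cs.simple j) ∧
      cs.length (cs.simple i * cs.simple j) = 2 := by
  have hi := i.isLt
  have hd (k : Fin 4) (hk : (k : ℕ) % 2 = i % 2) :
      cs.IsRightDescent (cs.simple i * cs.simple j) k := by
    rw [isRightDescent_iff, toPerm_commuting_apply cs hij, toPerm_commuting_apply cs hij,
      if_neg (by omega), if_pos (by omega)]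
    omega
  constructor
  · rw [isLongestDescentElement_iff, hg]
    refine ⟨mul_mem ?_ ?_, ?_⟩
    · exact simple_mem_standardParabolic cs (by simp)
    · exact simple_mem_standardParabolic cs (by simp)
    · rintro k (rfl | rfl)
      exacts [hd _ rfl, hd _ (by omega)]
  · have hdj := hd j (by omega)
    rw [cs.isRightDescent_iff, cs.simple_mul_simple_cancel_right, cs.length_simple] at hdj
    exact hdj.symm

theorem rightDescentSet_eq {g : W} {T : Set (Fin 4)}
    (h0 : toPerm cs g 1 < toPerm cs g 0 ↔ 0 ∈ T) (h1 : toPerm cs g 2 < toPerm cs g 1 ↔ 1 ∈ T)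
    (h2 : toPerm cs g 3 < toPerm cs g 2 ↔ 2 ∈ T) (h3 : toPerm cs g 4 < toPerm cs g 3 ↔ 3 ∈ T) :
    cs.rightDescentSet g = T := by
  ext k
  change cs.IsRightDescent g k ↔ k ∈ T
  fin_cases k
  · exact (isRightDescent_iff_toPerm_lt cs g 0 0 rfl).trans h0
  · exact (isRightDescent_iff_toPerm_lt cs g 1 1 rfl).trans h1
  · exact (isRightDescent_iff_toPerm_lt cs g 2 2 rfl).trans h2
  · exact (isRightDescent_iff_toPerm_lt cs g 3 3 rfl).trans h3

/-! ### Two diverging chains of standard prefixes -/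

/-- The translation by the coroot `e₁ - e₃`. -/
def translationOneThree : W :=
  (cs.simple 3 * cs.simple 0 * cs.simple 3) * (cs.simple 1 * cs.simple 2 * cs.simple 1)

/-- The translation by the coroot `e₄ - e₂`. -/
def translationFourTwo : W :=
  (cs.simple 2 * cs.simple 3 * cs.simple 2) * (cs.simple 0 * cs.simple 1 * cs.simple 0)

/-- The translation by `(3k, -k, -3k, k)`. -/
def dominantTranslation (k : ℕ) : W :=
  translationFourTwo cs ^ k * translationOneThree cs ^ (3 * k)

/-- The alternating product `a b a b ⋯` with `j` factors. -/
def alternatingProd (a b : W) : ℕ → W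
  | 0 => 1
  | j + 1 => alternatingProd a b j * if Even j then a else b

theorem toPerm_braid_three_zero (x : ℤ) :
    toPerm cs (cs.simple 3 * cs.simple 0 * cs.simple 3) x =
      if x % 4 = 3 then x + 2 else if x % 4 = 1 then x - 2 else x := by
  rw [toPerm_braid_apply cs (by decide)]
  simp only [Fin.isValue, Fin.coe_ofNat_eq_mod, Nat.reduceMod]
  split_ifs <;> omega

theorem toPerm_braid_one_two (x : ℤ) :
    toPerm cs (cs.simple 1 * cs.simple 2 * cs.simple 1) x =
      if x % 4 = 1 then x + 2 else if x % 4 = 3 then x - 2 else x := by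
  rw [toPerm_braid_apply cs (by decide)]
  simp only [Fin.isValue, Fin.coe_ofNat_eq_mod, Nat.reduceMod]
  split_ifs <;> omega

theorem toPerm_translationOneThree_pow (k : ℕ) (x : ℤ) :
    toPerm cs (translationOneThree cs ^ k) x =
      if x % 4 = 1 then x + 4 * k else if x % 4 = 3 then x - 4 * k else x := by
  induction k generalizing x with
  | zero => simp
  | succ k ih =>
    rw [pow_succ, map_mul, Equiv.Perm.mul_apply, ih, translationOneThree, map_mul,
      Equiv.Perm.mul_apply, toPerm_braid_one_two, toPerm_braid_three_zero]
    have hx : x % 4 = 0 ∨ x % 4 = 1 ∨ x % 4 = 2 ∨ x % 4 = 3 := by omega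
    rcases hx with hx | hx | hx | hx <;> simp (disch := omega) only [if_pos, if_neg] <;> omega

theorem toPerm_translationFourTwo_pow (k : ℕ) (x : ℤ) :
    toPerm cs (translationFourTwo cs ^ k) x =
      if x % 4 = 0 then x + 4 * k else if x % 4 = 2 then x - 4 * k else x := by
  induction k generalizing x with
  | zero => simp
  | succ k ih =>
    rw [pow_succ, map_mul, Equiv.Perm.mul_apply, ih, translationFourTwo, map_mul,
      Equiv.Perm.mul_apply, toPerm_braid_apply cs (by decide), toPerm_braid_apply cs (by decide)]
    simp only [Fin.isValue, Fin.coe_ofNat_eq_mod, Nat.reduceMod]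
    have hx : x % 4 = 0 ∨ x % 4 = 1 ∨ x % 4 = 2 ∨ x % 4 = 3 := by omega
    rcases hx with hx | hx | hx | hx <;> simp (disch := omega) only [if_pos, if_neg] <;> omega

theorem toPerm_dominantTranslation (k : ℕ) (x : ℤ) :
    toPerm cs (dominantTranslation cs k) x =
      if x % 4 = 0 then x + 4 * k else if x % 4 = 1 then x + 12 * k
      else if x % 4 = 2 then x - 4 * k else x - 12 * k := by
  rw [dominantTranslation, map_mul, Equiv.Perm.mul_apply, toPerm_translationOneThree_pow,
    toPerm_translationFourTwo_pow]
  have hx : x % 4 = 0 ∨ x % 4 = 1 ∨ x % 4 = 2 ∨ x % 4 = 3 := by omega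
  rcases hx with hx | hx | hx | hx <;> simp (disch := omega) only [if_pos, if_neg] <;> omega

theorem toPerm_alternatingProd_braid (j : ℕ) (x : ℤ) :
    toPerm cs (alternatingProd (cs.simple 1 * cs.simple 2 * cs.simple 1)
      (cs.simple 3 * cs.simple 0 * cs.simple 3) j) x =
      if x % 2 = 0 then x else if (x / 2 + j) % 2 = 1 then x + 2 * j else x - 2 * j := by
  induction j generalizing x with
  | zero => simp [alternatingProd]
  | succ j ih =>
    rw [alternatingProd, map_mul, Equiv.Perm.mul_apply, ih]
    have hx : x % 4 = 0 ∨ x % 4 = 1 ∨ x % 4 = 2 ∨ x % 4 = 3 := by omega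
    by_cases hj : Even j
    · rw [if_pos hj, toPerm_braid_one_two]
      rw [Nat.even_iff] at hj
      rcases hx with hx | hx | hx | hx <;> simp (disch := omega) only [if_pos, if_neg] <;> omega
    · rw [if_neg hj, toPerm_braid_three_zero]
      rw [Nat.even_iff] at hj
      rcases hx with hx | hx | hx | hx <;> simp (disch := omega) only [if_pos, if_neg] <;> omega

theorem toPerm_alternatingProd_commuting (j : ℕ) (x : ℤ) :
    toPerm cs (alternatingProd (cs.simple 0 * cs.simple 2) (cs.simple 1 * cs.simple 3) j) x =
      if (x + j) % 2 = 1 then x + j else x - j := by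
  induction j generalizing x with
  | zero => simp [alternatingProd]
  | succ j ih =>
    rw [alternatingProd, map_mul, Equiv.Perm.mul_apply, ih]
    by_cases hj : Even j
    · rw [if_pos hj, toPerm_commuting_apply cs (by decide)]
      rw [Nat.even_iff] at hj
      simp only [Fin.isValue, Fin.coe_ofNat_eq_mod, Nat.reduceMod]
      split_ifs <;> omega
    · rw [if_neg hj, toPerm_commuting_apply cs (by decide)]
      rw [Nat.even_iff] at hj
      simp only [Fin.isValue, Fin.coe_ofNat_eq_mod, Nat.reduceMod]
      split_ifs <;> omega

/-- After `j` steps even positions keep their values and odd positions have drifted by `2j ≤ 4k`.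
The values at odd positions stay outside those at even positions because `12(k+1)` exceeds `4(k+1)`
by more than this drift. -/
theorem exists_isLongestDescentElement_braid_chain (k j : ℕ) (hj : j ≤ 2 * k) :
    ∃ w, cs.IsLongestDescentElement (dominantTranslation cs (k + 1) *
        alternatingProd (cs.simple 1 * cs.simple 2 * cs.simple 1)
          (cs.simple 3 * cs.simple 0 * cs.simple 3) j) w ∧ cs.length w = 3 ∧
      dominantTranslation cs (k + 1) * alternatingProd (cs.simple 1 * cs.simple 2 * cs.simple 1)
          (cs.simple 3 * cs.simple 0 * cs.simple 3) (j + 1) =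
        dominantTranslation cs (k + 1) * alternatingProd (cs.simple 1 * cs.simple 2 * cs.simple 1)
          (cs.simple 3 * cs.simple 0 * cs.simple 3) j * w⁻¹ := by
  set g := dominantTranslation cs (k + 1) * alternatingProd
    (cs.simple 1 * cs.simple 2 * cs.simple 1) (cs.simple 3 * cs.simple 0 * cs.simple 3) j with hg
  have hval (x : ℤ) := toPerm_dominantTranslation cs (k + 1)
    (if x % 2 = 0 then x else if (x / 2 + j) % 2 = 1 then x + 2 * j else x - 2 * j)
  -- Folding the conditional into the alternating product turns the left side into `toPerm cs g x`;
  -- the next line unfolds it on the right.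
  simp only [← toPerm_alternatingProd_braid cs j, ← Equiv.Perm.mul_apply, ← map_mul, ← hg] at hval
  simp only [toPerm_alternatingProd_braid cs j] at hval
  have h0 := hval 0
  have h1 := hval 1
  have h2 := hval 2
  have h3 := hval 3
  have h4 := hval 4
  push_cast at h0 h1 h2 h3 h4
  by_cases hev : Even j
  · have hmod := Nat.even_iff.1 hev
    simp (disch := omega) only [if_pos, if_neg] at h0 h1 h2 h3 h4
    have hT : cs.rightDescentSet g = {1, 2} := by
      apply rightDescentSet_eq cs <;> simp <;> omega
    obtain ⟨hw, hl⟩ := isLongestDescentElement_braid cs (by decide) hT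
    exact ⟨_, hw, hl, by simp [hg, alternatingProd, hev, mul_assoc]⟩
  · have hmod := hev
    rw [Nat.even_iff] at hmod
    simp (disch := omega) only [if_pos, if_neg] at h0 h1 h2 h3 h4
    have hT : cs.rightDescentSet g = {3, 0} := by
      apply rightDescentSet_eq cs <;> simp <;> omega
    obtain ⟨hw, hl⟩ := isLongestDescentElement_braid cs (by decide) hT
    exact ⟨_, hw, hl, by simp [hg, alternatingProd, hev, mul_assoc]⟩

theorem toPerm_dominantTranslation_mul_simple_bounds (k : ℕ) (x : ℤ) :
    (x % 2 = 0 → x - 1 + 4 * k ≤ toPerm cs (dominantTranslation cs k * cs.simple 1) x) ∧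
    (x % 2 = 1 → toPerm cs (dominantTranslation cs k * cs.simple 1) x ≤ x + 1 - 4 * k) := by
  rw [map_mul, Equiv.Perm.mul_apply, toPerm_simple_apply, toPerm_dominantTranslation]
  simp only [Fin.isValue, Fin.coe_ofNat_eq_mod, Nat.reduceMod]
  have hx : x % 4 = 0 ∨ x % 4 = 1 ∨ x % 4 = 2 ∨ x % 4 = 3 := by omega
  rcases hx with hx | hx | hx | hx <;> simp (disch := omega) only [if_pos, if_neg] <;> omega

/-- High and low values alternate by parity of position, and each block exchanges the two parities.
The drift `j ≤ 2k` is too small to close the gap between high and low. -/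
theorem exists_isLongestDescentElement_commuting_chain (k j : ℕ) (hj : j ≤ 2 * k) :
    ∃ w, cs.IsLongestDescentElement (dominantTranslation cs (k + 1) * cs.simple 1 *
        alternatingProd (cs.simple 0 * cs.simple 2) (cs.simple 1 * cs.simple 3) j) w ∧
      cs.length w = 2 ∧
      dominantTranslation cs (k + 1) * cs.simple 1 *
          alternatingProd (cs.simple 0 * cs.simple 2) (cs.simple 1 * cs.simple 3) (j + 1) =
        dominantTranslation cs (k + 1) * cs.simple 1 *
          alternatingProd (cs.simple 0 * cs.simple 2) (cs.simple 1 * cs.simple 3) j * w⁻¹ := by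
  set g := dominantTranslation cs (k + 1) * cs.simple 1 *
    alternatingProd (cs.simple 0 * cs.simple 2) (cs.simple 1 * cs.simple 3) j with hg
  have hval (x : ℤ) : toPerm cs g x = toPerm cs (dominantTranslation cs (k + 1) * cs.simple 1)
      (if (x + j) % 2 = 1 then x + j else x - j) := by
    rw [hg, map_mul, Equiv.Perm.mul_apply, toPerm_alternatingProd_commuting]
  have hhigh (x : ℤ) (hx : (x + j) % 2 = 0) : x - j + 3 + 4 * k ≤ toPerm cs g x := by
    have := (toPerm_dominantTranslation_mul_simple_bounds cs (k + 1) (x - j)).1 (by omega)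
    rw [hval, if_neg (by omega)]
    push_cast at this
    linarith
  have hlow (x : ℤ) (hx : (x + j) % 2 = 1) : toPerm cs g x ≤ x + j - 3 - 4 * k := by
    have := (toPerm_dominantTranslation_mul_simple_bounds cs (k + 1) (x + j)).2 hx
    rw [hval, if_pos hx]
    push_cast at this
    linarith
  clear_value g
  have h02 := simple_mul_simple_comm cs (i := 0) (j := 2) rfl
  have h13 := simple_mul_simple_comm cs (i := 1) (j := 3) rfl
  by_cases hev : Even j
  · have hmod := Nat.even_iff.1 hev
    have h0 := hhigh 0 (by omega)
    have h1 := hlow 1 (by omega)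
    have h2 := hhigh 2 (by omega)
    have h3 := hlow 3 (by omega)
    have h4 := hhigh 4 (by omega)
    have hT : cs.rightDescentSet g = {0, 2} := by
      apply rightDescentSet_eq cs <;> simp <;> omega
    obtain ⟨hw, hl⟩ := isLongestDescentElement_commuting cs (by decide) hT
    exact ⟨_, hw, hl, by simp [hg, alternatingProd, hev, mul_assoc, h02]⟩
  · have hmod := hev
    rw [Nat.even_iff] at hmod
    have h0 := hlow 0 (by omega)
    have h1 := hhigh 1 (by omega)
    have h2 := hlow 2 (by omega)
    have h3 := hhigh 3 (by omega)
    have h4 := hlow 4 (by omega)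
    have hT : cs.rightDescentSet g = {1, 3} := by
      apply rightDescentSet_eq cs <;> simp <;> omega
    obtain ⟨hw, hl⟩ := isLongestDescentElement_commuting cs (by decide) hT
    exact ⟨_, hw, hl, by simp [hg, alternatingProd, hev, mul_assoc, h13]⟩

theorem le_length_inv_mul_chains (g : W) (r : ℕ) :
    3 * r ≤ cs.length ((g * alternatingProd (cs.simple 1 * cs.simple 2 * cs.simple 1)
        (cs.simple 3 * cs.simple 0 * cs.simple 3) (2 * r))⁻¹ *
      (g * cs.simple 1 *
        alternatingProd (cs.simple 0 * cs.simple 2) (cs.simple 1 * cs.simple 3) (3 * r))) := by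
  set a := alternatingProd (cs.simple 1 * cs.simple 2 * cs.simple 1)
    (cs.simple 3 * cs.simple 0 * cs.simple 3) (2 * r) with ha
  set b := alternatingProd (cs.simple 0 * cs.simple 2) (cs.simple 1 * cs.simple 3) (3 * r) with hb
  have e : (g * a)⁻¹ * (g * cs.simple 1 * b) = a⁻¹ * (cs.simple 1 * b) := by group
  -- The point `4 + 3r` is sent by `b` to `4`, which both `s₁` and `a` fix.
  have h := abs_toPerm_sub_le_length cs (a⁻¹ * (cs.simple 1 * b)) (4 + 3 * r)
  have hb4 : toPerm cs b (4 + 3 * r) = 4 := by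
    rw [hb, toPerm_alternatingProd_commuting, if_neg (by push_cast; omega)]
    push_cast
    ring
  have ha4 : (toPerm cs a)⁻¹ 4 = 4 := by
    rw [Equiv.Perm.inv_eq_iff_eq, ha, toPerm_alternatingProd_braid, if_pos (by norm_num)]
  have h14 : toPerm cs (cs.simple 1) 4 = 4 := by
    rw [toPerm_simple, adjacentSwap_of_ne (by simp) (by simp)]
  rw [map_mul, map_mul, map_inv, Equiv.Perm.mul_apply, Equiv.Perm.mul_apply, hb4, h14, ha4,
    abs_le] at h
  rw [e]
  omega

/-! ### Failure of the fellow traveller property -/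

theorem length_wordProd_take_inv_mul_le (v : List (Fin 4)) (a b : ℕ) :
    cs.length ((cs.wordProd (v.take a))⁻¹ * cs.wordProd (v.take b)) ≤ (a - b) + (b - a) := by
  wlog hab : a ≤ b generalizing a b
  · rw [← cs.length_inv, mul_inv_rev, inv_inv]
    have := this b a (by omega)
    omega
  have h : v.take b = v.take a ++ (v.drop a).take (b - a) := by
    rw [← List.take_add, Nat.add_sub_cancel' hab]
  rw [h, cs.wordProd_append, inv_mul_cancel_left]
  have h1 := cs.length_wordProd_le ((v.drop a).take (b - a))
  have h2 := List.length_take_le (b - a) (v.drop a)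
  omega

theorem standardWords_diverge (m : ℕ) {v v' : List (Fin 4)} (hv : cs.IsStandardWord v)
    (hv' : cs.IsStandardWord v') (hg : cs.wordProd v = dominantTranslation cs (m + 1))
    (hg' : cs.wordProd v' = dominantTranslation cs (m + 1) * cs.simple 1)
    {n : ℕ} (hn : n ≤ m) (hev : Even n) :
    3 * n ≤ v.length ∧ 3 * n ≤ v'.length ∧
      n ≤ cs.length ((cs.wordProd (v.take (v.length - 3 * n)))⁻¹ *
        cs.wordProd (v'.take (v'.length - 3 * n))) := by
  obtain ⟨r, rfl⟩ := hev
  obtain ⟨h1, -, h2⟩ := isStandardWord_take_of_chain cs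
    (fun j ↦ dominantTranslation cs (m + 1) *
      alternatingProd (cs.simple 1 * cs.simple 2 * cs.simple 1)
        (cs.simple 3 * cs.simple 0 * cs.simple 3) j) 3 (2 * m)
    (fun j hj ↦ exists_isLongestDescentElement_braid_chain cs m j hj.le) hv
    (by simpa [alternatingProd] using hg) (2 * r) (by omega)
  obtain ⟨h1', -, h2'⟩ := isStandardWord_take_of_chain cs
    (fun j ↦ dominantTranslation cs (m + 1) * cs.simple 1 *
      alternatingProd (cs.simple 0 * cs.simple 2) (cs.simple 1 * cs.simple 3) j) 2 (2 * m)
    (fun j hj ↦ exists_isLongestDescentElement_commuting_chain cs m j hj.le) hv'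
    (by simpa [alternatingProd] using hg') (3 * r) (by omega)
  have h3 := le_length_inv_mul_chains cs (dominantTranslation cs (m + 1)) r
  rw [show 3 * (r + r) = 3 * (2 * r) by ring, h2, show 3 * (2 * r) = 2 * (3 * r) by ring, h2']
  exact ⟨by omega, h1', by omega⟩

theorem not_fellowTravellerProperty : ¬ cs.FellowTravellerProperty cs.standardLanguage := by
  rintro ⟨C, -, hC⟩
  set c := ⌈C⌉₊
  obtain ⟨v, hv, hg⟩ := exists_isStandardWord cs (dominantTranslation cs (2 * (c + 2) + 1))
  obtain ⟨v', hv', hg'⟩ := exists_isStandardWord cs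
    (dominantTranslation cs (2 * (c + 2) + 1) * cs.simple 1)
  obtain ⟨h1, h2, h3⟩ := standardWords_diverge cs (2 * (c + 2)) hv hv' hg hg' le_rfl
    (even_two_mul _)
  -- The `+ 1` makes the index positive. Comparing prefixes at this common index costs at most 1 for
  -- `v` and 2 for `v'`, whose lengths differ by one; the chosen distance `2(c + 2)` exceeds the
  -- resulting bound `c + 3`.
  have h4 := hC 1 _ _ rfl v hv v' hv' hg hg' (v.length - 3 * (2 * (c + 2)) + 1) (by omega)
  have h5 : cs.length ((cs.wordProd (v.take (v.length - 3 * (2 * (c + 2)) + 1)))⁻¹ *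
      cs.wordProd (v'.take (v.length - 3 * (2 * (c + 2)) + 1))) ≤ c := by
    exact_mod_cast h4.trans (Nat.le_ceil C)
  have h6 := length_wordProd_take_inv_mul_le cs v (v.length - 3 * (2 * (c + 2)))
    (v.length - 3 * (2 * (c + 2)) + 1)
  have h7 := length_wordProd_take_inv_mul_le cs v' (v.length - 3 * (2 * (c + 2)) + 1)
    (v'.length - 3 * (2 * (c + 2)))
  have h8 : v'.length = v.length + 1 ∨ v'.length + 1 = v.length := by
    rw [IsStandardWord.length_eq cs hv, IsStandardWord.length_eq cs hv', hg, hg']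
    exact cs.length_mul_simple _ _
  set x := cs.wordProd (v.take (v.length - 3 * (2 * (c + 2))))
  set y := cs.wordProd (v.take (v.length - 3 * (2 * (c + 2)) + 1))
  set y' := cs.wordProd (v'.take (v.length - 3 * (2 * (c + 2)) + 1))
  set x' := cs.wordProd (v'.take (v'.length - 3 * (2 * (c + 2))))
  have h9 : x⁻¹ * x' = x⁻¹ * y * (y⁻¹ * y') * (y'⁻¹ * x') := by group
  have h10 := cs.length_mul_le (x⁻¹ * y * (y⁻¹ * y')) (y'⁻¹ * x')
  have h11 := cs.length_mul_le (x⁻¹ * y) (y⁻¹ * y')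
  rw [← h9] at h10
  omega

end AffineA3

/-- For the Euclidean Coxeter group `Ã₃`, the standard language does not satisfy part (ii) of the
definition of biautomaticity. Moreover, the failure is linear: for every `m` there are neighbours
`g`, `gs` such that, for any standard words `v`, `v'` representing them, of lengths `N`, `N'`, and
any even `n ≤ m`, the elements `v(N - 3n)` and `v'(N' - 3n)` are at distance at least `n`. -/
theorem theorem1p4 {W : Type*} [Group W] (cs : CoxeterSystem coxeterMatrixAffineA3 W) :
    ¬ cs.FellowTravellerProperty cs.standardLanguage ∧
    ∀ m : ℕ, ∃ (g : W) (s : Fin 4),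
      ∀ v ∈ cs.standardLanguage, ∀ v' ∈ cs.standardLanguage,
        cs.wordProd v = g → cs.wordProd v' = g * cs.simple s →
          ∀ n ≤ m, Even n →
            3 * n ≤ v.length ∧ 3 * n ≤ v'.length ∧
            n ≤ cs.length ((cs.wordProd (v.take (v.length - 3 * n)))⁻¹ *
              cs.wordProd (v'.take (v'.length - 3 * n))) :=
  ⟨AffineA3.not_fellowTravellerProperty cs, fun m ↦
    ⟨AffineA3.dominantTranslation cs (m + 1), 1, fun _ hv _ hv' hg hg' _ hn hev ↦
      AffineA3.standardWords_diverge cs m hv hv' hg hg' hn hev⟩⟩
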